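/- Let $d\ge 1$ and let $\gamma_d$ be the standard Gaussian measure on $\mathbb{R}^d$. For normed spaces $E_0,E_1$ contained in a common vector space, $\theta\in(0,1)$ and $q\in[1,\infty]$, let $(E_0,E_1)_{\theta,q}$ be the real interpolation space of all $x\in E_0+E_1$ such that $\lambda\mapsto\lambda^{-\theta}K(\lambda,x;E_0,E_1)$ belongs to $L_q((0,\infty),\frac{d\lambda}{\lambda})$, where $K(\lambda,x;E_0,E_1)=\inf\{\|x_0\|_{E_0}+\lambda\|x_1\|_{E_1}: x=x_0+x_1,\ x_i\in E_i\}$. Let $C_b^0(\mathbb{R}^d)$ be the space of bounded continuous functions $f:\mathbb{R}^d\to\mathbb{R}$ with $f(0)=0$, with the supremum norm, and let $\mathrm{Lip}^0(\mathbb{R}^d)$ be the space of Lipschitz functions $f:\mathbb{R}^d\to\mathbb{R}$ with $f(0)=0$, with the norm $|f|_{\mathrm{Lip}}=\sup_{x\ne y}|f(x)-f(y)|/|x-y|$, where $|\cdot|$ is the Euclidean norm. Let $(h_k)_{k\in\mathbb{N}_0^d}$ be the orthonormal basis of $L_2(\mathbb{R}^d,\gamma_d)$ of products of normalised Hermite polynomials,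 and let $\mathbb{D}_{1,2}(\mathbb{R}^d,\gamma_d)$ be the space of all $f\in L_2(\mathbb{R}^d,\gamma_d)$ with $\|Df\|^2:=\sum_k\langle f,h_k\rangle^2\,\|\nabla h_k\|^2_{L_2(\gamma_d)}<\infty$, with the norm $(\|f\|_{L_2(\gamma_d)}^2+\|Df\|^2)^{1/2}$. Let $$\mathbb{B}^\theta_{2,q}(\mathbb{R}^d,\gamma_d):=(L_2(\mathbb{R}^d,\gamma_d),\mathbb{D}_{1,2}(\mathbb{R}^d,\gamma_d))_{\theta,q}.$$ Then for all $\theta\in(0,1)$ and $1\le\underline{q}<\overline{q}\le\infty$, $$(C_b^0(\mathbb{R}^d),\mathrm{Lip}^0(\mathbb{R}^d))_{\theta,\overline{q}}\not\subseteq\mathbb{B}^\theta_{2,\underline{q}}(\mathbb{R}^d,\gamma_d),$$ where a function is identified with its $\gamma_d$-almost everywhere equivalence class. -/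

import Mathlib

open MeasureTheory ProbabilityTheory
open scoped ENNReal

noncomputable section

namespace SharpEmbedding

/-! ### Real interpolation

A normed space `E` that sits linearly inside a vector space `X` is given by its extended norm
`N : X → [0, ∞]`, which is the norm on `E` and `∞` outside `E`; so `E = {x | N x < ∞}`. -/

section Interpolation

variable {X : Type*} [AddCommGroup X]

/-- The functional `K(t, x; E₀, E₁) = inf {‖x₀‖_{E₀} + t ‖x₁‖_{E₁} : x = x₀ + x₁, xᵢ ∈ Eᵢ}`
for `t > 0`. It is `∞` exactly for `x ∉ E₀ + E₁`: a decomposition with some `xᵢ ∉ Eᵢ`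
contributes `∞`. -/
def kFunctional (N₀ N₁ : X → ℝ≥0∞) (t : ℝ) (x : X) : ℝ≥0∞ :=
  ⨅ (x₀ : X) (x₁ : X) (_ : x = x₀ + x₁), N₀ x₀ + ENNReal.ofReal t * N₁ x₁

/-- The measure `dt / t` on `(0, ∞)`. -/
def haarIoi : Measure ℝ :=
  (volume.restrict (Set.Ioi (0 : ℝ))).withDensity fun t => ENNReal.ofReal t⁻¹

/-- The norm of `t ↦ t ^ (-θ) K(t, x; E₀, E₁)` in `L_q((0, ∞), dt / t)`. -/
def interpolationNorm (N₀ N₁ : X → ℝ≥0∞) (θ : ℝ) (q : ℝ≥0∞) (x : X) : ℝ≥0∞ :=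
  eLpNorm (fun t : ℝ => ENNReal.ofReal (t ^ (-θ)) * kFunctional N₀ N₁ t x) q haarIoi

/-- The real interpolation space `(E₀, E₁)_{θ,q}`: all `x ∈ E₀ + E₁` with finite
interpolation norm. -/
def interpolationSpace (N₀ N₁ : X → ℝ≥0∞) (θ : ℝ) (q : ℝ≥0∞) : Set X :=
  {x | (∃ x₀ x₁ : X, N₀ x₀ < ∞ ∧ N₁ x₁ < ∞ ∧ x = x₀ + x₁) ∧
    interpolationNorm N₀ N₁ θ q x < ∞}

end Interpolation

/-! ### Hölder spaces -/

open Classical in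
/-- The (extended) norm of `C_b^0(ℝᵈ)`: the supremum norm on the continuous bounded functions
that vanish at `0`. -/
def cbZeroNorm (d : ℕ) (f : EuclideanSpace ℝ (Fin d) → ℝ) : ℝ≥0∞ :=
  if Continuous f ∧ f 0 = 0 then ⨆ x, ‖f x‖ₑ else ∞

open Classical in
/-- The (extended) norm of `Lip^0(ℝᵈ)`: the Lipschitz constant `sup_{x ≠ y} |f x - f y| / |x - y|`
on the Lipschitz functions that vanish at `0`. -/
def lipZeroNorm (d : ℕ) (f : EuclideanSpace ℝ (Fin d) → ℝ) : ℝ≥0∞ :=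
  if f 0 = 0 then ⨆ (x) (y) (_ : x ≠ y), ‖f x - f y‖ₑ / ‖x - y‖ₑ else ∞

/-- The Hölder space `(C_b^0(ℝᵈ), Lip^0(ℝᵈ))_{θ,q}`. -/
def hoelderSpace (d : ℕ) (θ : ℝ) (q : ℝ≥0∞) : Set (EuclideanSpace ℝ (Fin d) → ℝ) :=
  interpolationSpace (cbZeroNorm d) (lipZeroNorm d) θ q

/-! ### Gaussian Besov spaces -/

/-- The standard Gaussian measure `γ_d` on `ℝᵈ`. -/
abbrev gaussian (d : ℕ) : Measure (EuclideanSpace ℝ (Fin d)) :=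
  stdGaussian (EuclideanSpace ℝ (Fin d))

/-- The Hermite polynomial of degree `k`, normalised in `L₂(ℝ, γ₁)`. -/
def hermiteFun (k : ℕ) (x : ℝ) : ℝ :=
  Polynomial.aeval x (Polynomial.hermite k) / √(k.factorial : ℝ)

/-- The generalised Hermite polynomials `h_{k₁}(x₁) ⋯ h_{k_d}(x_d)`. -/
def hermiteProd {d : ℕ} (k : Fin d → ℕ) (x : EuclideanSpace ℝ (Fin d)) : ℝ :=
  ∏ i, hermiteFun (k i) (x i)

/-- The (extended) squared norm `‖Df‖² = ∑ₖ ⟨f, hₖ⟩² ‖∇ hₖ‖²` of the derivative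
`Df = ∑ₖ ⟨f, hₖ⟩ ∇ hₖ`; the gradients `∇ hₖ` are pairwise orthogonal in `L₂(γ_d; ℝᵈ)`. -/
def derivNormSq (d : ℕ) (f : Lp ℝ 2 (gaussian d)) : ℝ≥0∞ :=
  ∑' k : Fin d → ℕ, ‖∫ x, f x * hermiteProd k x ∂(gaussian d)‖ₑ ^ 2 *
    ∫⁻ x, ‖gradient (hermiteProd k) x‖ₑ ^ 2 ∂(gaussian d)

/-- The (extended) norm `(‖f‖² + ‖Df‖²)^{1/2}` of the Gaussian Sobolev space
`𝔻_{1,2}(ℝᵈ, γ_d) ⊆ L₂(ℝᵈ, γ_d)`; it is finite iff the series in `derivNormSq` converges. -/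
def sobolevNorm (d : ℕ) (f : Lp ℝ 2 (gaussian d)) : ℝ≥0∞ :=
  (‖f‖ₑ ^ 2 + derivNormSq d f) ^ (1 / 2 : ℝ)

/-- The Gaussian Besov space `𝔹^θ_{2,q}(ℝᵈ, γ_d) = (L₂(γ_d), 𝔻_{1,2}(γ_d))_{θ,q}`. -/
def gaussianBesov (d : ℕ) (θ : ℝ) (q : ℝ≥0∞) : Set (Lp ℝ 2 (gaussian d)) :=
  interpolationSpace (fun f : Lp ℝ 2 (gaussian d) => ‖f‖ₑ) (sobolevNorm d) θ q

end SharpEmbedding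

end

open MeasureTheory ProbabilityTheory
open scoped ENNReal

namespace SharpEmbedding

open Polynomial Real

/-! The witness is a lacunary series in one coordinate, `f x = ∑ₙ (n + 1) ^ (-s) e ^ (-θ n) sin (e ^
n xᵢ)` with `s = 1 / q₁`. Put `t = e ^ (-v)`, which turns `dt / t` into `dv`.

Cutting the series at frequency `1 / t` bounds `t ^ (-θ) K(t, f; C_b^0, Lip^0)` by a multiple of `(1
+ |v|) ^ (-s)` (`exists_rpow_mul_kFunctional_le`), which lies in `L_q(dv)` for every `q > q₁`. It
remains to see that the Gaussian `K`-functional is no smaller: `t ^ (-θ) K(t, f; L₂, 𝔻_{1,2})` is at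
least a multiple of `v ^ (-s)` for `v ≥ 2`, and `v ^ (-s q₁) = 1 / v` is not integrable at infinity.

The lower bound is `ofReal_half_le_kFunctional_lacunary`. The Hermite coefficient of `sin (l x)` at
degree `2j + 1` is `(-1) ^ j l ^ k e ^ (-l² / 2) / √k!` with `k = 2j + 1`. Its sign does not depend
on `l > 0`, so the frequencies of `f` cannot cancel and each coefficient of `f` dominates that of
any single term. The squares are Poisson weights of mean `l²`, so a term of frequency `l` lives at
degrees near `l²`, and pairing with a suitable Hermite sum detects half of its amplitude. -/

/-! ### Hermite polynomials under the one-dimensional Gaussian measure. -/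

theorem derivative_hermite_succ (n : ℕ) :
    derivative (hermite (n + 1)) = (n + 1 : ℤ[X]) * hermite n := by
  induction n with
  | zero => simp [hermite_zero]
  | succ n ih =>
    rw [hermite_succ (n + 1), derivative_sub, derivative_mul, ih, derivative_mul]
    have h := hermite_succ n
    simp only [derivative_X, derivative_add, derivative_natCast, derivative_one]
    push_cast
    linear_combination (-(n : ℤ[X]) - 1) * h

theorem integrable_aeval_gaussianReal (P : ℤ[X]) :
    Integrable (fun x : ℝ => aeval x P) (gaussianReal 0 1) := by
  induction P using Polynomial.induction_on' with
  | add p q hp hq =>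
    simp only [map_add]
    exact hp.add hq
  | monomial n a =>
    simp only [aeval_monomial]
    refine Integrable.const_mul ?_ _
    have h := (memLp_id_gaussianReal' (μ := 0) (v := 1) (n : ℝ≥0∞) (by simp)).integrable_norm_pow'
    refine (integrable_norm_iff (by fun_prop)).1 ?_
    simpa using h

theorem memLp_aeval_gaussianReal (P : ℤ[X]) :
    MemLp (fun x : ℝ => aeval x P) 2 (gaussianReal 0 1) := by
  rw [memLp_two_iff_integrable_sq (by fun_prop)]
  simpa [sq] using integrable_aeval_gaussianReal (P * P)

/-- Gaussian integration by parts (Stein's identity). -/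
theorem integral_id_mul_gaussianReal {f f' : ℝ → ℝ} (hf : ∀ x, HasDerivAt f (f' x) x)
    (h₀ : Integrable f (gaussianReal 0 1)) (h₁ : Integrable f' (gaussianReal 0 1))
    (h₂ : Integrable (fun x => x * f x) (gaussianReal 0 1)) :
    ∫ x, x * f x ∂(gaussianReal 0 1) = ∫ x, f' x ∂(gaussianReal 0 1) := by
  have key : ∀ g : ℝ → ℝ, Integrable g (gaussianReal 0 1) →
      Integrable (fun x => gaussianPDFReal 0 1 x * g x) volume := by
    intro g hg
    rw [gaussianReal_of_var_ne_zero 0 one_ne_zero,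
      integrable_withDensity_iff_integrable_smul' (measurable_gaussianPDF 0 1)
        (by filter_upwards with x using gaussianPDF_lt_top)] at hg
    simpa [toReal_gaussianPDF] using hg
  have hpdf : ∀ x, HasDerivAt (gaussianPDFReal 0 1) (-x * gaussianPDFReal 0 1 x) x := by
    intro x
    have h : HasDerivAt (fun y : ℝ => -(y - 0) ^ 2 / (2 * ((1 : NNReal) : ℝ))) (-x) x := by
      have := (((hasDerivAt_id x).sub_const 0).pow 2).neg.div_const (2 * ((1 : NNReal) : ℝ))
      refine this.congr_deriv ?_
      simp
      ring
    have h2 := h.exp.const_mul (√(2 * π * ((1 : NNReal) : ℝ)))⁻¹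
    rw [gaussianPDFReal_def]
    refine h2.congr_deriv ?_
    ring
  -- The density `p` satisfies `p' = -x p`, so `(p f)' = p (f' - x f)`, and this has integral zero.
  have hd : ∀ x, HasDerivAt (fun x => gaussianPDFReal 0 1 x * f x)
      (gaussianPDFReal 0 1 x * f' x - gaussianPDFReal 0 1 x * (x * f x)) x := by
    intro x
    refine ((hpdf x).mul (hf x)).congr_deriv ?_
    ring
  have h := integral_eq_zero_of_hasDerivAt_of_integrable hd ((key _ h₁).sub (key _ h₂)) (key _ h₀)
  rw [integral_sub (key _ h₁) (key _ h₂)] at h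
  rw [integral_gaussianReal_eq_integral_smul one_ne_zero,
    integral_gaussianReal_eq_integral_smul one_ne_zero]
  simp only [smul_eq_mul]
  linarith

/-- Stein's identity for `f * hermite n`: since `hermite (n + 1) = X * hermite n - (hermite n)'`,
raising the degree is adjoint to differentiation. -/
theorem integral_mul_hermite_succ {f f' : ℝ → ℝ} (hf : ∀ x, HasDerivAt f (f' x) x)
    (h₀ : ∀ P : ℤ[X], Integrable (fun x => f x * aeval x P) (gaussianReal 0 1))
    (h₁ : ∀ P : ℤ[X], Integrable (fun x => f' x * aeval x P) (gaussianReal 0 1)) (n : ℕ) :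
    ∫ x, f x * aeval x (hermite (n + 1)) ∂(gaussianReal 0 1) =
      ∫ x, f' x * aeval x (hermite n) ∂(gaussianReal 0 1) := by
  have hd : ∀ x, HasDerivAt (fun x => f x * aeval x (hermite n))
      (f' x * aeval x (hermite n) + f x * aeval x (derivative (hermite n))) x := fun x =>
    (hf x).mul (Polynomial.hasDerivAt_aeval _ _)
  have hX : (fun x => f x * aeval x (X * hermite n)) =
      fun x => x * (f x * aeval x (hermite n)) := by
    ext x
    simp only [map_mul, aeval_X]
    ring
  have h := integral_id_mul_gaussianReal hd (h₀ _) ((h₁ _).add (h₀ _)) (hX ▸ h₀ (X * hermite n))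
  rw [integral_add (h₁ _) (h₀ _), ← hX] at h
  rw [hermite_succ]
  simp only [map_sub, mul_sub]
  rw [integral_sub (h₀ _) (h₀ _), h]
  ring

theorem integral_hermite_mul_hermite (m n : ℕ) :
    ∫ x, aeval x (hermite m) * aeval x (hermite n) ∂(gaussianReal 0 1) =
      if m = n then (n.factorial : ℝ) else 0 := by
  have hi : ∀ P Q : ℤ[X], Integrable (fun x : ℝ => aeval x P * aeval x Q) (gaussianReal 0 1) := by
    intro P Q
    simpa using integrable_aeval_gaussianReal (P * Q)
  have step : ∀ (P : ℤ[X]) (n : ℕ),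
      ∫ x, aeval x P * aeval x (hermite (n + 1)) ∂(gaussianReal 0 1) =
        ∫ x, aeval x (derivative P) * aeval x (hermite n) ∂(gaussianReal 0 1) := fun P n =>
    integral_mul_hermite_succ (fun x => Polynomial.hasDerivAt_aeval P x) (hi P) (hi _) n
  induction n generalizing m with
  | zero =>
    cases m with
    | zero => simp [hermite_zero]
    | succ m =>
      simp_rw [mul_comm (aeval _ (hermite (m + 1)))]
      rw [step]
      simp [hermite_zero]
  | succ n ih =>
    rw [step]
    cases m with
    | zero => simp [hermite_zero]
    | succ m =>
      rw [derivative_hermite_succ]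
      simp only [map_mul, mul_assoc, map_add, map_natCast, map_one]
      rw [integral_const_mul, ih]
      by_cases h : m = n
      · subst h
        simp [Nat.factorial_succ]
      · simp [h]

theorem integrable_mul_aeval_of_bounded {f : ℝ → ℝ} (hf : Continuous f) (hb : ∃ C, ∀ x, |f x| ≤ C)
    (P : ℤ[X]) : Integrable (fun x => f x * aeval x P) (gaussianReal 0 1) := by
  obtain ⟨C, hC⟩ := hb
  exact (integrable_aeval_gaussianReal P).bdd_mul (c := C) hf.aestronglyMeasurable
    (by filter_upwards with x using hC x)

/-! ### Hermite coefficients of sine and cosine. -/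

theorem integral_cos_gaussianReal (l : ℝ) :
    ∫ x, cos (l * x) ∂(gaussianReal 0 1) = exp (-(l ^ 2 / 2)) := by
  have h := charFun_gaussianReal (μ := 0) (v := 1) l
  rw [charFun_apply_real] at h
  have hint : Integrable (fun x : ℝ => Complex.exp (l * x * Complex.I)) (gaussianReal 0 1) := by
    refine Integrable.of_bound (C := 1) (by fun_prop) ?_
    filter_upwards with x
    rw [← Complex.ofReal_mul, Complex.norm_exp_ofReal_mul_I]
  have h2 := congrArg Complex.re h
  have h3 := integral_re (𝕜 := ℂ) hint
  simp only [RCLike.re_to_complex] at h3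
  rw [← h3] at h2
  have h4 : ∀ x : ℝ, (Complex.exp (l * x * Complex.I)).re = cos (l * x) := by
    intro x
    rw [← Complex.ofReal_mul, Complex.exp_ofReal_mul_I_re]
  simp_rw [h4] at h2
  rw [h2]
  rw [← Complex.exp_ofReal_re]
  congr 2
  push_cast
  simp

/-- Each lowering of the degree differentiates the trigonometric factor, so the two families must be
treated in one induction. It starts from the characteristic function. -/
theorem integral_cos_sin_mul_hermite (l : ℝ) (j : ℕ) :
    (∫ x, cos (l * x) * aeval x (hermite (2 * j)) ∂(gaussianReal 0 1) =
      (-1) ^ j * l ^ (2 * j) * exp (-(l ^ 2 / 2))) ∧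
    ∫ x, sin (l * x) * aeval x (hermite (2 * j + 1)) ∂(gaussianReal 0 1) =
      (-1) ^ j * l ^ (2 * j + 1) * exp (-(l ^ 2 / 2)) := by
  have hm : ∀ x : ℝ, HasDerivAt (fun x => l * x) l x := fun x => by
    simpa using (hasDerivAt_id x).const_mul l
  have hs : ∀ x : ℝ, HasDerivAt (fun x => sin (l * x)) (l * cos (l * x)) x := fun x => by
    simpa [mul_comm] using (hm x).sin
  have hc : ∀ x : ℝ, HasDerivAt (fun x => cos (l * x)) (-l * sin (l * x)) x := fun x => by
    simpa [mul_comm] using (hm x).cos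
  have is : ∀ a : ℝ, ∀ P : ℤ[X],
      Integrable (fun x => a * sin (l * x) * aeval x P) (gaussianReal 0 1) := fun a P =>
    integrable_mul_aeval_of_bounded (by fun_prop) ⟨|a|, fun x => by
      rw [abs_mul]; exact mul_le_of_le_one_right (abs_nonneg a) (abs_sin_le_one _)⟩ P
  have ic : ∀ a : ℝ, ∀ P : ℤ[X],
      Integrable (fun x => a * cos (l * x) * aeval x P) (gaussianReal 0 1) := fun a P =>
    integrable_mul_aeval_of_bounded (by fun_prop) ⟨|a|, fun x => by
      rw [abs_mul]; exact mul_le_of_le_one_right (abs_nonneg a) (abs_cos_le_one _)⟩ P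
  have ss : ∀ n, ∫ x, sin (l * x) * aeval x (hermite (n + 1)) ∂(gaussianReal 0 1) =
      l * ∫ x, cos (l * x) * aeval x (hermite n) ∂(gaussianReal 0 1) := fun n => by
    rw [integral_mul_hermite_succ hs (by simpa using is 1) (ic l)]
    simp_rw [mul_assoc]
    rw [integral_const_mul]
  have cc : ∀ n, ∫ x, cos (l * x) * aeval x (hermite (n + 1)) ∂(gaussianReal 0 1) =
      -l * ∫ x, sin (l * x) * aeval x (hermite n) ∂(gaussianReal 0 1) := fun n => by
    rw [integral_mul_hermite_succ hc (by simpa using ic 1) (is (-l))]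
    simp_rw [mul_assoc]
    rw [integral_const_mul]
  induction j with
  | zero =>
    have h0 : ∫ x, cos (l * x) * aeval x (hermite 0) ∂(gaussianReal 0 1) = exp (-(l ^ 2 / 2)) := by
      simp [hermite_zero, integral_cos_gaussianReal]
    refine ⟨by simpa using h0, ?_⟩
    rw [ss, mul_zero, h0]
    ring
  | succ j ih =>
    have h0 : ∫ x, cos (l * x) * aeval x (hermite (2 * (j + 1))) ∂(gaussianReal 0 1) =
        (-1) ^ (j + 1) * l ^ (2 * (j + 1)) * exp (-(l ^ 2 / 2)) := by
      rw [show 2 * (j + 1) = 2 * j + 1 + 1 by ring, cc, ih.2]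
      ring
    refine ⟨h0, ?_⟩
    rw [ss, h0]
    ring

/-! ### Hermite functions of one coordinate on `ℝᵈ`. -/

variable {d : ℕ}

theorem map_apply_gaussian (i : Fin d) :
    (gaussian d).map (fun x => x i) = gaussianReal 0 1 := by
  rw [gaussian, ← map_pi_eq_stdGaussian, Measure.map_map (by fun_prop) (by fun_prop)]
  exact (measurePreserving_eval (fun _ : Fin d => gaussianReal 0 1) i).map_eq

theorem integral_gaussian_comp_apply (i : Fin d) {F : ℝ → ℝ} (hF : Continuous F) :
    ∫ x, F (x i) ∂(gaussian d) = ∫ y, F y ∂(gaussianReal 0 1) := by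
  rw [← map_apply_gaussian i, integral_map (by fun_prop) hF.aestronglyMeasurable]

theorem continuous_hermiteFun (k : ℕ) : Continuous (hermiteFun k) := by
  unfold hermiteFun
  fun_prop

theorem memLp_hermiteFun (k : ℕ) : MemLp (hermiteFun k) 2 (gaussianReal 0 1) := by
  have h := (memLp_aeval_gaussianReal (hermite k)).const_mul (√(k.factorial : ℝ))⁻¹
  refine h.ae_eq ?_
  filter_upwards with x
  rw [hermiteFun, div_eq_inv_mul]

theorem hermiteProd_single (i : Fin d) (k : ℕ) (x : EuclideanSpace ℝ (Fin d)) :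
    hermiteProd (Pi.single i k) x = hermiteFun k (x i) := by
  rw [hermiteProd, Finset.prod_eq_single i]
  · simp
  · intro j _ hj
    simp [Pi.single_eq_of_ne hj, hermiteFun, hermite_zero]
  · simp

theorem memLp_hermiteProd_single (i : Fin d) (k : ℕ) :
    MemLp (hermiteProd (Pi.single i k)) 2 (gaussian d) := by
  have h : MemLp (hermiteFun k) 2 ((gaussian d).map (fun x => x i)) := by
    rw [map_apply_gaussian]; exact memLp_hermiteFun k
  rw [show hermiteProd (Pi.single i k) = hermiteFun k ∘ fun x => x i from
    funext (hermiteProd_single i k)]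
  exact h.comp_of_map (by fun_prop)

theorem integral_hermiteFun_mul_hermiteFun (m n : ℕ) :
    ∫ x, hermiteFun m x * hermiteFun n x ∂(gaussianReal 0 1) = if m = n then 1 else 0 := by
  have h : ∀ x : ℝ, hermiteFun m x * hermiteFun n x =
      (√(m.factorial : ℝ) * √(n.factorial : ℝ))⁻¹ *
        (aeval x (hermite m) * aeval x (hermite n)) := by
    intro x
    simp only [hermiteFun]
    field_simp
  simp_rw [h]
  rw [integral_const_mul, integral_hermite_mul_hermite]
  split_ifs with hmn
  · subst hmn
    rw [mul_self_sqrt (by positivity)]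
    exact inv_mul_cancel₀ (by positivity)
  · simp

theorem orthonormal_hermiteProd_single (i : Fin d) :
    Orthonormal ℝ fun k : ℕ => (memLp_hermiteProd_single i k).toLp := by
  rw [orthonormal_iff_ite]
  intro m n
  rw [L2.inner_def]
  have h : ∀ᵐ x ∂(gaussian d), inner ℝ ((memLp_hermiteProd_single i m).toLp _ x)
      ((memLp_hermiteProd_single i n).toLp _ x) = hermiteFun m (x i) * hermiteFun n (x i) := by
    filter_upwards [(memLp_hermiteProd_single i m).coeFn_toLp,
      (memLp_hermiteProd_single i n).coeFn_toLp] with x hm hn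
    rw [hm, hn, hermiteProd_single, hermiteProd_single]
    simp [mul_comm]
  rw [integral_congr_ae h, integral_gaussian_comp_apply i
    (F := fun y => hermiteFun m y * hermiteFun n y)
    ((continuous_hermiteFun m).mul (continuous_hermiteFun n)),
    integral_hermiteFun_mul_hermiteFun]

/-- The coefficient of `f` at the Hermite polynomial of degree `k` in the variable `x i`. -/
noncomputable def hermiteCoeff (i : Fin d) (k : ℕ) (f : Lp ℝ 2 (gaussian d)) : ℝ :=
  ∫ x, f x * hermiteProd (Pi.single i k) x ∂(gaussian d)

theorem hermiteCoeff_add (i : Fin d) (k : ℕ) (f g : Lp ℝ 2 (gaussian d)) :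
    hermiteCoeff i k (f + g) = hermiteCoeff i k f + hermiteCoeff i k g := by
  have hi : ∀ f : Lp ℝ 2 (gaussian d),
      Integrable (fun x => f x * hermiteProd (Pi.single i k) x) (gaussian d) := fun f =>
    (Lp.memLp f).integrable_mul (memLp_hermiteProd_single i k)
  rw [hermiteCoeff, hermiteCoeff, hermiteCoeff, ← integral_add (hi f) (hi g)]
  refine integral_congr_ae ?_
  filter_upwards [Lp.coeFn_add f g] with x hx
  rw [hx, Pi.add_apply, add_mul]

theorem sum_hermiteCoeff_sq_le (i : Fin d) (s : Finset ℕ) (f : Lp ℝ 2 (gaussian d)) :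
    ∑ k ∈ s, ‖hermiteCoeff i k f‖ₑ ^ 2 ≤ ‖f‖ₑ ^ 2 := by
  have h := (orthonormal_hermiteProd_single i).sum_inner_products_le (s := s) f
  have h2 : ∀ k, inner ℝ ((memLp_hermiteProd_single i k).toLp) f = hermiteCoeff i k f := by
    intro k
    rw [L2.inner_def, hermiteCoeff]
    refine integral_congr_ae ?_
    filter_upwards [(memLp_hermiteProd_single i k).coeFn_toLp] with x hx
    rw [hx]
    simp
  simp_rw [h2] at h
  have h3 := ENNReal.ofReal_le_ofReal h
  rw [ENNReal.ofReal_sum_of_nonneg (fun _ _ => by positivity)] at h3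
  simpa only [ENNReal.ofReal_pow (norm_nonneg _), ofReal_norm] using h3

/-- The gradient is `√k h_{k-1}(xᵢ) eᵢ`, and `h_{k-1}` is normalised. -/
theorem lintegral_gradient_hermiteProd_single (i : Fin d) (k : ℕ) :
    ∫⁻ x, ‖gradient (hermiteProd (Pi.single i k)) x‖ₑ ^ 2 ∂(gaussian d) = k := by
  have hg : ∀ x, gradient (hermiteProd (Pi.single i k)) x =
      (aeval (x i) (derivative (hermite k)) / √(k.factorial : ℝ)) •
        EuclideanSpace.single i (1 : ℝ) := by
    intro x
    have h1 : HasDerivAt (hermiteFun k)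
        (aeval (x i) (derivative (hermite k)) / √(k.factorial : ℝ)) (x i) :=
      (Polynomial.hasDerivAt_aeval _ _).div_const _
    have h2 : HasFDerivAt (fun x : EuclideanSpace ℝ (Fin d) => x i)
        (EuclideanSpace.proj i : EuclideanSpace ℝ (Fin d) →L[ℝ] ℝ) x :=
      (EuclideanSpace.proj i : EuclideanSpace ℝ (Fin d) →L[ℝ] ℝ).hasFDerivAt
    have h3 := h1.comp_hasFDerivAt x h2
    rw [show hermiteProd (Pi.single i k) = hermiteFun k ∘ fun x => x i from
      funext (hermiteProd_single i k)]
    refine HasGradientAt.gradient ?_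
    rw [hasGradientAt_iff_hasFDerivAt]
    refine h3.congr_fderiv ?_
    ext y
    simp [EuclideanSpace.inner_single_left]
  cases k with
  | zero =>
    simp_rw [hg]
    simp [hermite_zero]
  | succ k =>
    have h4 : ∀ x : EuclideanSpace ℝ (Fin d),
        ‖gradient (hermiteProd (Pi.single i (k + 1))) x‖ₑ ^ 2 =
          ENNReal.ofReal ((k + 1) * (hermiteFun k (x i) * hermiteFun k (x i))) := by
      intro x
      rw [hg, enorm_smul, mul_pow, ← ofReal_norm, ← ofReal_norm, PiLp.norm_single,
        norm_one, ENNReal.ofReal_one, one_pow, mul_one, ← ENNReal.ofReal_pow (norm_nonneg _),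
        derivative_hermite_succ, hermiteFun]
      congr 1
      simp only [norm_eq_abs, sq_abs, map_mul, map_add, map_natCast, map_one,
        Nat.factorial_succ, Nat.cast_mul, Nat.cast_add, Nat.cast_one]
      rw [div_pow, mul_pow, sq_sqrt (by positivity), div_mul_div_comm,
        mul_self_sqrt (by positivity)]
      field_simp
    have hint : Integrable (fun y => hermiteFun k y * hermiteFun k y) (gaussianReal 0 1) :=
      (memLp_hermiteFun k).integrable_mul (memLp_hermiteFun k)
    have hc := continuous_hermiteFun k
    have hF : Continuous fun y => ((k : ℝ) + 1) * (hermiteFun k y * hermiteFun k y) := by fun_prop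
    simp_rw [h4]
    rw [← ofReal_integral_eq_lintegral_ofReal]
    · rw [integral_gaussian_comp_apply i hF, integral_const_mul,
        integral_hermiteFun_mul_hermiteFun]
      simp [ENNReal.ofReal_add]
    · have := hint.const_mul ((k : ℝ) + 1)
      rw [← map_apply_gaussian i] at this
      exact this.comp_measurable (by fun_prop)
    · filter_upwards with x
      have := mul_self_nonneg (hermiteFun k (x i))
      simp only [Pi.zero_apply]
      positivity

theorem sum_natCast_mul_hermiteCoeff_sq_le (i : Fin d) (s : Finset ℕ) (f : Lp ℝ 2 (gaussian d)) :
    ∑ k ∈ s, (k : ℝ≥0∞) * ‖hermiteCoeff i k f‖ₑ ^ 2 ≤ derivNormSq d f := by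
  have h : ∀ k : ℕ, (k : ℝ≥0∞) * ‖hermiteCoeff i k f‖ₑ ^ 2 =
      ‖∫ x, f x * hermiteProd (Pi.single i k) x ∂(gaussian d)‖ₑ ^ 2 *
        ∫⁻ x, ‖gradient (hermiteProd (Pi.single i k)) x‖ₑ ^ 2 ∂(gaussian d) := by
    intro k
    rw [lintegral_gradient_hermiteProd_single, mul_comm, hermiteCoeff]
  simp_rw [h]
  refine (ENNReal.sum_le_tsum s).trans ?_
  exact ENNReal.tsum_comp_le_tsum_of_injective (Pi.single_injective i)
    (fun k : Fin d → ℕ => ‖∫ x, f x * hermiteProd k x ∂(gaussian d)‖ₑ ^ 2 *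
      ∫⁻ x, ‖gradient (hermiteProd k) x‖ₑ ^ 2 ∂(gaussian d))

/-! ### Duality for the Gaussian `K`-functional. -/

theorem sum_mul_le_of_sum_sq_le {ι : Type*} (s : Finset ι) (f g : ι → ℝ≥0∞) {A B : ℝ≥0∞}
    (hf : ∑ k ∈ s, f k ^ 2 ≤ A ^ 2) (hg : ∑ k ∈ s, g k ^ 2 ≤ B ^ 2) :
    ∑ k ∈ s, f k * g k ≤ A * B := by
  have h := ENNReal.inner_le_Lp_mul_Lq s f g Real.HolderConjugate.two_two
  simp only [ENNReal.rpow_two] at h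
  have key : ∀ {S C : ℝ≥0∞}, S ≤ C ^ 2 → S ^ (1 / 2 : ℝ) ≤ C := by
    intro S C hS
    have h1 := ENNReal.rpow_le_rpow hS (show (0 : ℝ) ≤ 1 / 2 by norm_num)
    rwa [← ENNReal.rpow_two, ← ENNReal.rpow_mul, show (2 : ℝ) * (1 / 2) = 1 by norm_num,
      ENNReal.rpow_one] at h1
  exact h.trans (mul_le_mul' (key hf) (key hg))

/-- A lower bound of the `K`-functional of `(L₂, 𝔻_{1,2})` by duality with a finite combination
of Hermite polynomials in one variable. -/
theorem sum_hermiteCoeff_mul_le_kFunctional (i : Fin d) (s : Finset ℕ) (φ : ℕ → ℝ≥0∞) {t : ℝ}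
    (h₀ : ∑ k ∈ s, k * φ k ^ 2 ≤ 1) (h₁ : ∑ k ∈ s, φ k ^ 2 ≤ ENNReal.ofReal t ^ 2)
    (f : Lp ℝ 2 (gaussian d)) :
    ∑ k ∈ s, ‖hermiteCoeff i k f‖ₑ * ((k : ℝ≥0∞) ^ (1 / 2 : ℝ) * φ k) ≤
      kFunctional (fun f : Lp ℝ 2 (gaussian d) => ‖f‖ₑ) (sobolevNorm d) t f := by
  have hsq : ∀ k : ℝ≥0∞, (k ^ (1 / 2 : ℝ)) ^ 2 = k := by
    intro k
    rw [← ENNReal.rpow_two, ← ENNReal.rpow_mul, show (1 / 2 : ℝ) * 2 = 1 by norm_num,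
      ENNReal.rpow_one]
  refine le_iInf fun g => le_iInf fun h => le_iInf fun hgh => ?_
  subst hgh
  calc ∑ k ∈ s, ‖hermiteCoeff i k (g + h)‖ₑ * ((k : ℝ≥0∞) ^ (1 / 2 : ℝ) * φ k)
      ≤ ∑ k ∈ s, (‖hermiteCoeff i k g‖ₑ * ((k : ℝ≥0∞) ^ (1 / 2 : ℝ) * φ k) +
          ((k : ℝ≥0∞) ^ (1 / 2 : ℝ) * ‖hermiteCoeff i k h‖ₑ) * φ k) := by
        refine Finset.sum_le_sum fun k _ => ?_
        rw [hermiteCoeff_add]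
        calc _ ≤ (‖hermiteCoeff i k g‖ₑ + ‖hermiteCoeff i k h‖ₑ) *
              ((k : ℝ≥0∞) ^ (1 / 2 : ℝ) * φ k) := by gcongr; exact enorm_add_le _ _
          _ = _ := by ring
    -- Cauchy–Schwarz twice: the weight `√k` stays with `φ` for the `L₂` part and moves to the
    -- coefficients for the Sobolev part.
    _ ≤ ‖g‖ₑ * 1 + sobolevNorm d h * ENNReal.ofReal t := by
        rw [Finset.sum_add_distrib]
        gcongr
        · refine sum_mul_le_of_sum_sq_le s _ _ (sum_hermiteCoeff_sq_le i s g) ?_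
          simpa only [mul_pow, hsq, one_pow] using h₀
        · refine sum_mul_le_of_sum_sq_le s _ _ ?_ h₁
          simp only [mul_pow, hsq, sobolevNorm]
          exact (sum_natCast_mul_hermiteCoeff_sq_le i s h).trans le_add_self
    _ = _ := by rw [mul_one, mul_comm (sobolevNorm d h)]

/-! ### Hermite coefficients of lacunary series. -/

/-- The lacunary sine series with coefficients `b n` and frequencies `exp n`. -/
noncomputable def lacunary (b : ℕ → ℝ) (y : ℝ) : ℝ :=
  ∑' n : ℕ, b n * sin (exp n * y)

theorem abs_mul_sin_le {b : ℝ} (hb : 0 ≤ b) (y : ℝ) : |b * sin y| ≤ b := by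
  rw [abs_mul, abs_of_nonneg hb]
  exact mul_le_of_le_one_right hb (abs_sin_le_one _)

theorem continuous_lacunary {b : ℕ → ℝ} (hb : ∀ n, 0 ≤ b n) (hs : Summable b) :
    Continuous (lacunary b) :=
  continuous_tsum (fun n => by fun_prop) hs fun n y => abs_mul_sin_le (hb n) _

/-- The absolute value of the coefficient of `x ↦ sin (l * x)` at the normalised Hermite polynomial
of odd degree `k`. -/
noncomputable def sinCoeff (l : ℝ) (k : ℕ) : ℝ :=
  l ^ k * exp (-(l ^ 2 / 2)) / √(k.factorial : ℝ)

theorem sinCoeff_nonneg {l : ℝ} (hl : 0 ≤ l) (k : ℕ) : 0 ≤ sinCoeff l k := by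
  unfold sinCoeff
  positivity

theorem integral_sin_mul_hermiteFun (l : ℝ) (j : ℕ) :
    ∫ x, sin (l * x) * hermiteFun (2 * j + 1) x ∂(gaussianReal 0 1) =
      (-1) ^ j * sinCoeff l (2 * j + 1) := by
  simp_rw [hermiteFun, ← mul_div_assoc]
  rw [integral_div, (integral_cos_sin_mul_hermite l j).2, sinCoeff]
  ring

theorem hasSum_integral_lacunary_mul_hermiteFun {b : ℕ → ℝ} (hb : ∀ n, 0 ≤ b n) (hs : Summable b)
    (j : ℕ) :
    HasSum (fun n : ℕ => b n * ((-1) ^ j * sinCoeff (exp n) (2 * j + 1)))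
      (∫ x, lacunary b x * hermiteFun (2 * j + 1) x ∂(gaussianReal 0 1)) := by
  set h := hermiteFun (2 * j + 1) with hh
  have hint : Integrable h (gaussianReal 0 1) := (memLp_hermiteFun _).integrable one_le_two
  have hi : ∀ n : ℕ, Integrable (fun x => b n * sin (exp n * x) * h x) (gaussianReal 0 1) :=
    fun n => hint.bdd_mul (c := b n) (by fun_prop)
      (by filter_upwards with x using abs_mul_sin_le (hb n) _)
  have hsum : Summable fun n : ℕ => ∫ x, ‖b n * sin (exp n * x) * h x‖ ∂(gaussianReal 0 1) := by
    refine Summable.of_nonneg_of_le (fun n => integral_nonneg fun x => norm_nonneg _) (fun n => ?_)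
      (hs.mul_right (∫ x, ‖h x‖ ∂(gaussianReal 0 1)))
    rw [← integral_const_mul]
    refine integral_mono (hi n).norm (hint.norm.const_mul _) fun x => ?_
    rw [norm_mul]
    exact mul_le_mul_of_nonneg_right (abs_mul_sin_le (hb n) _) (norm_nonneg _)
  have key := hasSum_integral_of_summable_integral_norm hi hsum
  have e : ∀ n : ℕ, ∫ x, b n * sin (exp n * x) * h x ∂(gaussianReal 0 1) =
      b n * ((-1) ^ j * sinCoeff (exp n) (2 * j + 1)) := by
    intro n
    rw [← integral_sin_mul_hermiteFun, ← integral_const_mul]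
    simp_rw [mul_assoc, hh]
  simp_rw [e, tsum_mul_right] at key
  exact key

/-- After multiplication by the common sign `(-1) ^ j` all contributions are nonnegative, so one of
them bounds the sum from below. -/
theorem mul_sinCoeff_le_abs_hermiteCoeff (i : Fin d) {b : ℕ → ℝ} (hb : ∀ n, 0 ≤ b n)
    (hs : Summable b) {f : Lp ℝ 2 (gaussian d)}
    (hf : f =ᵐ[gaussian d] fun x => lacunary b (x i)) (m j : ℕ) :
    b m * sinCoeff (exp m) (2 * j + 1) ≤ |hermiteCoeff i (2 * j + 1) f| := by
  have hc := continuous_lacunary hb hs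
  have h1 : hermiteCoeff i (2 * j + 1) f =
      ∫ x, lacunary b x * hermiteFun (2 * j + 1) x ∂(gaussianReal 0 1) := by
    rw [← integral_gaussian_comp_apply i
      (F := fun y => lacunary b y * hermiteFun (2 * j + 1) y)
      (hc.mul (continuous_hermiteFun _)), hermiteCoeff]
    refine integral_congr_ae ?_
    filter_upwards [hf] with x hx
    rw [hx, hermiteProd_single]
  have h2 := (hasSum_integral_lacunary_mul_hermiteFun hb hs j).mul_left ((-1) ^ j)
  have h3 : ((-1 : ℝ) ^ j) * (-1) ^ j = 1 := by rw [← mul_pow]; simp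
  have h4 : ∀ n : ℕ, (-1) ^ j * (b n * ((-1) ^ j * sinCoeff (exp n) (2 * j + 1))) =
      b n * sinCoeff (exp n) (2 * j + 1) := by
    intro n
    linear_combination (b n * sinCoeff (exp n) (2 * j + 1)) * h3
  simp_rw [h4, ← h1] at h2
  refine (le_hasSum h2 m fun n _ => mul_nonneg (hb n)
    (sinCoeff_nonneg (exp_pos _).le _)).trans ((le_abs_self _).trans ?_)
  rw [abs_mul, abs_pow, abs_neg, abs_one, one_pow, one_mul]

/-! ### Poisson sums and the lower bound. -/

/-- The Poisson identity `k P(k) = l² P(k - 1)` for mean `l²`, at `k = 2j + 1`. -/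
theorem sinCoeff_sq_mul {l : ℝ} (j : ℕ) :
    sinCoeff l (2 * j + 1) ^ 2 * ((2 * j + 1 : ℕ) : ℝ) =
      exp (-l ^ 2) * l ^ 2 * ((l ^ 2) ^ (2 * j) / ((2 * j).factorial : ℝ)) := by
  rw [sinCoeff, div_pow, sq_sqrt (by positivity), mul_pow, ← exp_nat_mul, Nat.factorial_succ,
    show ((2 : ℕ) : ℝ) * -(l ^ 2 / 2) = -l ^ 2 by push_cast; ring]
  have h1 : ((2 * j + 1 : ℕ) : ℝ) ≠ 0 := by positivity
  have h2 : ((2 * j).factorial : ℝ) ≠ 0 := by positivity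
  rw [Nat.cast_mul]
  field_simp
  ring

theorem sum_pow_even_div_factorial_le {y : ℝ} (hy : 0 ≤ y) (N : ℕ) :
    ∑ j ∈ Finset.range N, y ^ (2 * j) / ((2 * j).factorial : ℝ) ≤ exp y := by
  refine (sum_le_hasSum _ (fun j _ => by positivity) (hasSum_cosh y)).trans ?_
  rw [← cosh_add_sinh]
  exact le_add_of_nonneg_right (sinh_nonneg_iff.2 hy)

/-- Splitting `2j + 1` into `2j` and `1` gives `y * y ^ (2j-1) / (2j-1)!` and, as `y ≥ 1`, at most
`y * y ^ (2j) / (2j)!`. Together these fill in the odd and even terms of `y * exp y`. -/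
theorem sum_mul_pow_even_div_factorial_le {y : ℝ} (hy : 1 ≤ y) (N : ℕ) :
    ∑ j ∈ Finset.range N, ((2 * j + 1 : ℕ) : ℝ) * (y ^ (2 * j) / ((2 * j).factorial : ℝ)) ≤
      y * exp y := by
  have h : ∀ N : ℕ,
      ∑ j ∈ Finset.range (N + 1), ((2 * j + 1 : ℕ) : ℝ) * (y ^ (2 * j) / ((2 * j).factorial : ℝ)) ≤
        y * ∑ i ∈ Finset.range (2 * N + 1), y ^ i / (i.factorial : ℝ) := by
    intro N
    induction N with
    | zero => simpa using hy
    | succ N ih =>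
      rw [Finset.sum_range_succ, show 2 * (N + 1) = 2 * N + 1 + 1 by ring,
        Finset.sum_range_succ _ (2 * N + 1 + 1), Finset.sum_range_succ _ (2 * N + 1),
        add_assoc (∑ i ∈ Finset.range (2 * N + 1), _), mul_add]
      refine add_le_add ih ?_
      rw [Nat.factorial_succ (2 * N + 1)]
      have hf : (0 : ℝ) < ((2 * N + 1).factorial : ℝ) := by positivity
      have hk : (0 : ℝ) < ((2 * N + 1 + 1 : ℕ) : ℝ) := by positivity
      rw [Nat.cast_mul, Nat.cast_add (2 * N + 1 + 1) 1, Nat.cast_one, add_mul, one_mul, mul_add]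
      have e1 : ((2 * N + 1 + 1 : ℕ) : ℝ) *
          (y ^ (2 * N + 1 + 1) / (((2 * N + 1 + 1 : ℕ) : ℝ) * ((2 * N + 1).factorial : ℝ))) =
          y * (y ^ (2 * N + 1) / ((2 * N + 1).factorial : ℝ)) := by
        field_simp
        ring
      rw [e1]
      refine add_le_add le_rfl (le_mul_of_one_le_left (by positivity) hy)
  calc _ ≤ ∑ j ∈ Finset.range (N + 1),
        ((2 * j + 1 : ℕ) : ℝ) * (y ^ (2 * j) / ((2 * j).factorial : ℝ)) := by
        rw [Finset.sum_range_succ]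
        exact le_add_of_nonneg_right (by positivity)
    _ ≤ _ := (h N).trans (by gcongr; exact sum_le_exp_of_nonneg (by linarith) _)

theorem ofReal_half_le_kFunctional_lacunary (i : Fin d) {b : ℕ → ℝ} (hb : ∀ n, 0 ≤ b n)
    (hs : Summable b) {f : Lp ℝ 2 (gaussian d)}
    (hf : f =ᵐ[gaussian d] fun x => lacunary b (x i)) (m : ℕ) {t : ℝ} (ht : exp (-m) ≤ t) :
    ENNReal.ofReal (b m / 2) ≤
      kFunctional (fun f : Lp ℝ 2 (gaussian d) => ‖f‖ₑ) (sobolevNorm d) t f := by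
  set l : ℝ := exp m with hl
  have hl1 : 1 ≤ l := one_le_exp (Nat.cast_nonneg m)
  have hl0 : 0 < l := by linarith
  have hy1 : 1 ≤ l ^ 2 := one_le_pow₀ hl1
  have hlt : l⁻¹ ≤ t := by rwa [hl, ← exp_neg]
  have hexp : exp (-l ^ 2) * exp (l ^ 2) = 1 := by rw [← exp_add]; simp
  -- The test sequence is aligned with the term of frequency `l`. Since `k` is typically of size
  -- `l²`, the scaling `l⁻²` makes `∑ k q k ^ 2 ≤ 1` and `∑ q k ^ 2 ≤ l⁻² ≤ t²`.
  set q : ℕ → ℝ := fun k => sinCoeff l k * √(k : ℝ) / l ^ 2 with hq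
  have hq0 : ∀ k, 0 ≤ q k := fun k => by
    have := sinCoeff_nonneg hl0.le k
    positivity
  have hqsq : ∀ j : ℕ, q (2 * j + 1) ^ 2 =
      exp (-l ^ 2) * (l ^ 2)⁻¹ * ((l ^ 2) ^ (2 * j) / ((2 * j).factorial : ℝ)) := by
    intro j
    have h := sinCoeff_sq_mul (l := l) j
    simp only [hq]
    rw [div_pow, mul_pow, sq_sqrt (by positivity), h]
    field_simp
  have hodd : Function.Injective fun j : ℕ => 2 * j + 1 := fun a b hab => by
    simp only at hab
    omega
  have hN : ∀ N : ℕ, ENNReal.ofReal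
      (b m * exp (-l ^ 2) *
        ∑ j ∈ Finset.range N, (l ^ 2) ^ (2 * j) / ((2 * j).factorial : ℝ)) ≤
      kFunctional (fun f : Lp ℝ 2 (gaussian d) => ‖f‖ₑ) (sobolevNorm d) t f := by
    intro N
    refine le_trans ?_ (sum_hermiteCoeff_mul_le_kFunctional i
      ((Finset.range N).map ⟨fun j => 2 * j + 1, hodd⟩) (fun k => ENNReal.ofReal (q k)) ?_ ?_ f)
    · rw [Finset.sum_map, Finset.mul_sum, ENNReal.ofReal_sum_of_nonneg
        (fun j _ => mul_nonneg (mul_nonneg (hb m) (exp_pos _).le) (by positivity))]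
      refine Finset.sum_le_sum fun j _ => ?_
      simp only [Function.Embedding.coeFn_mk]
      rw [Real.enorm_eq_ofReal_abs, ← ENNReal.ofReal_natCast, ENNReal.ofReal_rpow_of_nonneg
        (by positivity) (by norm_num), ← sqrt_eq_rpow, ← ENNReal.ofReal_mul (sqrt_nonneg _),
        ← ENNReal.ofReal_mul (abs_nonneg _)]
      refine ENNReal.ofReal_le_ofReal ?_
      have h1 := mul_sinCoeff_le_abs_hermiteCoeff i hb hs hf m j
      rw [← hl] at h1
      refine le_trans (le_of_eq ?_) (mul_le_mul_of_nonneg_right h1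
        (mul_nonneg (sqrt_nonneg _) (hq0 _)))
      have h2 := sinCoeff_sq_mul (l := l) j
      have h3 : √((2 * j + 1 : ℕ) : ℝ) * √((2 * j + 1 : ℕ) : ℝ) = ((2 * j + 1 : ℕ) : ℝ) :=
        mul_self_sqrt (by positivity)
      calc _ = b m * (exp (-l ^ 2) * l ^ 2 * ((l ^ 2) ^ (2 * j) / ((2 * j).factorial : ℝ))) /
            l ^ 2 := by field_simp
        _ = b m * (sinCoeff l (2 * j + 1) ^ 2 *
            (√((2 * j + 1 : ℕ) : ℝ) * √((2 * j + 1 : ℕ) : ℝ))) / l ^ 2 := by rw [← h2, h3]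
        _ = _ := by simp only [hq]; ring
    · rw [Finset.sum_map]
      simp only [Function.Embedding.coeFn_mk]
      simp_rw [← ENNReal.ofReal_pow (hq0 _), hqsq, ← ENNReal.ofReal_natCast]
      simp_rw [← ENNReal.ofReal_mul (Nat.cast_nonneg _)]
      rw [← ENNReal.ofReal_sum_of_nonneg (fun j _ => by positivity)]
      refine ENNReal.ofReal_le_one.2 ?_
      have h := sum_mul_pow_even_div_factorial_le hy1 N
      calc _ = exp (-l ^ 2) * (l ^ 2)⁻¹ * ∑ j ∈ Finset.range N,
            ((2 * j + 1 : ℕ) : ℝ) * ((l ^ 2) ^ (2 * j) / ((2 * j).factorial : ℝ)) := by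
            rw [Finset.mul_sum]
            exact Finset.sum_congr rfl fun j _ => by ring
        _ ≤ exp (-l ^ 2) * (l ^ 2)⁻¹ * (l ^ 2 * exp (l ^ 2)) := by gcongr
        _ = exp (-l ^ 2) * exp (l ^ 2) := by field_simp
        _ ≤ 1 := hexp.le
    · rw [Finset.sum_map]
      simp only [Function.Embedding.coeFn_mk]
      simp_rw [← ENNReal.ofReal_pow (hq0 _), hqsq]
      rw [← ENNReal.ofReal_sum_of_nonneg (fun j _ => by positivity),
        ← ENNReal.ofReal_pow ((inv_pos.2 hl0).le.trans hlt), ← Finset.mul_sum]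
      refine ENNReal.ofReal_le_ofReal ?_
      calc _ ≤ exp (-l ^ 2) * (l ^ 2)⁻¹ * exp (l ^ 2) := by
            gcongr
            exact sum_pow_even_div_factorial_le (by positivity) N
        _ = (l⁻¹) ^ 2 := by rw [inv_pow]; linear_combination (l ^ 2)⁻¹ * hexp
        _ ≤ t ^ 2 := by gcongr
  -- As `N → ∞` the pairing tends to `b m` times the Poisson mass of the even integers, which is at
  -- least `1 / 2`.
  refine le_trans (ENNReal.ofReal_le_ofReal (?_ : _ ≤ b m * exp (-l ^ 2) * cosh (l ^ 2)))
    (le_of_tendsto' (ENNReal.tendsto_ofReal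
      (((hasSum_cosh (l ^ 2)).tendsto_sum_nat).const_mul (b m * exp (-l ^ 2)))) hN)
  have h1 : exp (l ^ 2) / 2 ≤ cosh (l ^ 2) := by
    rw [cosh_eq]
    have := exp_pos (-l ^ 2)
    linarith
  calc b m / 2 = b m * exp (-l ^ 2) * (exp (l ^ 2) / 2) := by linear_combination -(b m / 2) * hexp
    _ ≤ _ := mul_le_mul_of_nonneg_left h1 (mul_nonneg (hb m) (exp_pos _).le)

/-! ### The measure `dt / t` in logarithmic coordinates. -/

/-- No measurability of `G` is assumed, so none has to be shown for the `K`-functionals. -/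
theorem lintegral_haarIoi (G : ℝ → ℝ≥0∞) :
    ∫⁻ t, G t ∂haarIoi = ∫⁻ v, G (exp (-v)) := by
  have himg : (fun v : ℝ => exp (-v)) '' Set.univ = Set.Ioi 0 := by
    ext t
    simp only [Set.image_univ, Set.mem_range, Set.mem_Ioi]
    constructor
    · rintro ⟨v, rfl⟩
      exact exp_pos _
    · intro ht
      exact ⟨-log t, by rw [neg_neg, exp_log ht]⟩
  rw [haarIoi, lintegral_withDensity_eq_lintegral_mul_non_measurable _ (by fun_prop)
    (by filter_upwards with x using ENNReal.ofReal_lt_top), ← himg,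
    lintegral_image_eq_lintegral_abs_deriv_mul MeasurableSet.univ
      (f' := fun v => exp (-v) * (-1))
      (fun v _ => (hasDerivAt_neg v).exp.hasDerivWithinAt)
      (fun a _ b _ hab => by simpa using hab), Measure.restrict_univ]
  refine lintegral_congr fun v => ?_
  rw [Pi.mul_apply, ← mul_assoc, ← ENNReal.ofReal_mul (abs_nonneg _), mul_neg_one, abs_neg,
    abs_of_pos (exp_pos _), mul_inv_cancel₀ (exp_pos _).ne', ENNReal.ofReal_one, one_mul]

theorem ae_haarIoi_pos : ∀ᵐ t ∂haarIoi, 0 < t :=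
  (withDensity_absolutelyContinuous _ _).ae_le (ae_restrict_mem measurableSet_Ioi)

/-! ### The Hölder `K`-functional of a lacunary series. -/

theorem lacunary_add {b₁ b₂ : ℕ → ℝ} (h₁ : ∀ n, 0 ≤ b₁ n) (h₂ : ∀ n, 0 ≤ b₂ n)
    (hs₁ : Summable b₁) (hs₂ : Summable b₂) (y : ℝ) :
    lacunary (fun n => b₁ n + b₂ n) y = lacunary b₁ y + lacunary b₂ y := by
  simp only [lacunary, add_mul]
  exact (Summable.of_norm_bounded hs₁ fun n => abs_mul_sin_le (h₁ n) _).tsum_add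
    (Summable.of_norm_bounded hs₂ fun n => abs_mul_sin_le (h₂ n) _)

theorem lacunary_zero_right (b : ℕ → ℝ) : lacunary b 0 = 0 := by simp [lacunary]

theorem cbZeroNorm_lacunary_le (i : Fin d) {b : ℕ → ℝ} (hb : ∀ n, 0 ≤ b n) (hs : Summable b) :
    cbZeroNorm d (fun x => lacunary b (x i)) ≤ ENNReal.ofReal (∑' n, b n) := by
  have hc := continuous_lacunary hb hs
  rw [cbZeroNorm, if_pos ⟨by fun_prop, by simp [lacunary_zero_right]⟩]
  refine iSup_le fun x => ?_
  rw [← ofReal_norm]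
  exact ENNReal.ofReal_le_ofReal
    (tsum_of_norm_bounded hs.hasSum fun n => abs_mul_sin_le (hb n) _)

theorem lipZeroNorm_lacunary_le (i : Fin d) {b : ℕ → ℝ} (hb : ∀ n, 0 ≤ b n) (hs : Summable b)
    (hs' : Summable fun n : ℕ => b n * exp n) :
    lipZeroNorm d (fun x => lacunary b (x i)) ≤ ENNReal.ofReal (∑' n : ℕ, b n * exp n) := by
  rw [lipZeroNorm, if_pos (by simp [lacunary_zero_right])]
  refine iSup_le fun x => iSup_le fun y => iSup_le fun _ => ENNReal.div_le_of_le_mul ?_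
  rw [← ofReal_norm, ← ofReal_norm, ← ENNReal.ofReal_mul (tsum_nonneg fun n => by
    have := hb n
    positivity)]
  refine ENNReal.ofReal_le_ofReal ?_
  have hsum : ∀ y, Summable fun n : ℕ => b n * sin (exp n * y) := fun y =>
    Summable.of_norm_bounded hs fun n => abs_mul_sin_le (hb n) _
  rw [lacunary, lacunary, ← (hsum _).tsum_sub (hsum _)]
  refine tsum_of_norm_bounded (hs'.hasSum.mul_right _) fun n => ?_
  have h1 : |x i - y i| ≤ ‖x - y‖ := PiLp.norm_apply_le (x - y) i
  have h2 := abs_sin_sub_sin_le (exp n * x i) (exp n * y i)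
  rw [← mul_sub, abs_mul, abs_of_pos (exp_pos _)] at h2
  rw [← mul_sub, norm_eq_abs, abs_mul, abs_of_nonneg (hb n), mul_assoc]
  exact mul_le_mul_of_nonneg_left (h2.trans (by gcongr)) (hb n)

/-- The decomposition of a lacunary series into the frequencies below and above `t⁻¹`. -/
theorem kFunctional_lacunary_le (i : Fin d) {b : ℕ → ℝ} (hb : ∀ n, 0 ≤ b n) (hs : Summable b)
    {t : ℝ} (ht : 0 < t) :
    kFunctional (cbZeroNorm d) (lipZeroNorm d) t (fun x => lacunary b (x i)) ≤
      ENNReal.ofReal (∑' n : ℕ, b n * min 1 (t * exp n)) := by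
  set b₀ : ℕ → ℝ := fun n => if t * exp n ≤ 1 then 0 else b n with hb₀
  set b₁ : ℕ → ℝ := fun n => if t * exp n ≤ 1 then b n else 0 with hb₁
  have h₀ : ∀ n, 0 ≤ b₀ n := fun n => by
    simp only [hb₀]; split_ifs <;> simp [hb n]
  have h₁ : ∀ n, 0 ≤ b₁ n := fun n => by
    simp only [hb₁]; split_ifs <;> simp [hb n]
  have hs₀ : Summable b₀ := hs.of_nonneg_of_le h₀ fun n => by
    simp only [hb₀]; split_ifs <;> simp [hb n]
  have hs₁ : Summable b₁ := hs.of_nonneg_of_le h₁ fun n => by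
    simp only [hb₁]; split_ifs <;> simp [hb n]
  have hs₁' : Summable fun n : ℕ => b₁ n * exp n := by
    refine (hs.mul_right t⁻¹).of_nonneg_of_le (fun n => mul_nonneg (h₁ n) (exp_pos _).le) fun n => ?_
    simp only [hb₁]
    split_ifs with h
    · refine mul_le_mul_of_nonneg_left ?_ (hb n)
      rw [← one_div, le_div_iff₀' ht]
      exact h
    · rw [zero_mul]
      exact mul_nonneg (hb n) (inv_pos.2 ht).le
  have hsplit : (fun x : EuclideanSpace ℝ (Fin d) => lacunary b (x i)) =
      (fun x => lacunary b₀ (x i)) + fun x => lacunary b₁ (x i) := by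
    ext x
    rw [Pi.add_apply, ← lacunary_add h₀ h₁ hs₀ hs₁]
    congr 1
    ext n
    simp only [hb₀, hb₁]
    split_ifs <;> simp
  unfold kFunctional
  refine iInf_le_of_le _ (iInf_le_of_le _ (iInf_le_of_le hsplit ?_))
  refine (add_le_add (cbZeroNorm_lacunary_le i h₀ hs₀)
    (mul_le_mul' le_rfl (lipZeroNorm_lacunary_le i h₁ hs₁ hs₁'))).trans ?_
  rw [← ENNReal.ofReal_mul ht.le, ← ENNReal.ofReal_add (tsum_nonneg h₀) (mul_nonneg ht.le
    (tsum_nonneg fun n => mul_nonneg (h₁ n) (exp_pos _).le)), ← tsum_mul_left,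
    ← hs₀.tsum_add (hs₁'.mul_left t)]
  refine ENNReal.ofReal_le_ofReal (le_of_eq (tsum_congr fun n => ?_))
  simp only [hb₀, hb₁]
  split_ifs with h
  · rw [min_eq_right h]
    ring
  · rw [min_eq_left (not_le.1 h).le]
    ring

/-! ### Exponential sums and logarithmic weights. -/

theorem summable_exp_neg_mul_abs_int {c : ℝ} (hc : 0 < c) :
    Summable fun z : ℤ => exp (-(c * |(z : ℝ)|)) := by
  have h : Summable fun n : ℕ => exp (-(c * |(n : ℝ)|)) := by
    refine (summable_exp_nat_mul_of_ge (c := -c) (by linarith) (f := fun n => (n : ℝ))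
      (fun n => le_rfl)).congr fun n => ?_
    rw [Nat.abs_cast, neg_mul]
  exact Summable.of_nat_of_neg (by simpa using h) (by simpa using h)

/-- Replacing `v` by `⌊v⌋` costs a factor `exp c`; the shifted sum is then part of a fixed sum over
`ℤ`, uniformly in `v`. -/
theorem exists_tsum_exp_neg_mul_abs_sub_le {c : ℝ} (hc : 0 < c) :
    ∃ C : ℝ, 0 ≤ C ∧ ∀ v : ℝ, (Summable fun n : ℕ => exp (-(c * |n - v|))) ∧
      ∑' n : ℕ, exp (-(c * |n - v|)) ≤ C := by
  have hs := summable_exp_neg_mul_abs_int hc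
  refine ⟨exp c * ∑' z : ℤ, exp (-(c * |(z : ℝ)|)),
    mul_nonneg (exp_pos _).le (tsum_nonneg fun _ => (exp_pos _).le), fun v => ?_⟩
  have hinj : Function.Injective fun n : ℕ => (n : ℤ) - ⌊v⌋ := fun a b hab => by
    simpa using hab
  have hle : ∀ n : ℕ, exp (-(c * |n - v|)) ≤
      exp c * exp (-(c * |(((n : ℤ) - ⌊v⌋ : ℤ) : ℝ)|)) := by
    intro n
    rw [← exp_add, exp_le_exp]
    have h1 : |(((n : ℤ) - ⌊v⌋ : ℤ) : ℝ)| ≤ |n - v| + 1 := by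
      push_cast
      have h2 : |v - ⌊v⌋| ≤ 1 := by
        rw [abs_of_nonneg (by linarith [Int.floor_le v])]
        linarith [Int.lt_floor_add_one v]
      calc |(n : ℝ) - ⌊v⌋| = |(n - v) + (v - ⌊v⌋)| := by congr 1; ring
        _ ≤ _ := (abs_add_le _ _).trans (by linarith)
    nlinarith
  have hs2 := (hs.comp_injective hinj).mul_left (exp c)
  have hs3 := hs2.of_nonneg_of_le (fun n => (exp_pos _).le) hle
  refine ⟨hs3, (hs3.tsum_le_tsum hle hs2).trans ?_⟩
  rw [tsum_mul_left]
  gcongr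
  exact tsum_comp_le_tsum_of_inj hs (fun _ => (exp_pos _).le) hinj

/-- The coefficients of a lacunary series of smoothness `θ` and logarithmic decay `s`. -/
noncomputable def logCoeff (θ s : ℝ) (n : ℕ) : ℝ :=
  ((n : ℝ) + 1) ^ (-s) * exp (-(θ * n))

theorem logCoeff_nonneg (θ s : ℝ) (n : ℕ) : 0 ≤ logCoeff θ s n := by
  unfold logCoeff
  positivity

theorem summable_logCoeff {θ s : ℝ} (hθ : 0 < θ) (hs : 0 ≤ s) : Summable (logCoeff θ s) := by
  have h := Real.summable_exp_nat_mul_iff.mpr (neg_lt_zero.2 hθ)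
  refine h.of_nonneg_of_le (logCoeff_nonneg θ s) fun n => ?_
  rw [logCoeff, show (n : ℝ) * -θ = -(θ * n) by ring]
  refine mul_le_of_le_one_left (exp_pos _).le ?_
  exact rpow_le_one_of_one_le_of_nonpos (by linarith [Nat.cast_nonneg (α := ℝ) n]) (by linarith)

/-- A Peetre-type inequality, from `1 + |v| ≤ (n + 1) (1 + |n - v|)`. It moves the logarithmic
weight from `n` to `v` at a linear cost that exponential decay absorbs. -/
theorem rpow_neg_le_mul_of_abs_sub {s : ℝ} (hs : 0 ≤ s) (hs1 : s ≤ 1) (n : ℕ) (v : ℝ) :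
    ((n : ℝ) + 1) ^ (-s) ≤ (1 + |v|) ^ (-s) * (1 + |n - v|) := by
  have hn : (0 : ℝ) ≤ n := Nat.cast_nonneg n
  have h1 : 1 + |v| ≤ ((n : ℝ) + 1) * (1 + |n - v|) := by
    have h2 : |v| ≤ n + |n - v| := by
      calc |v| = |n - (n - v)| := by congr 1; ring
        _ ≤ |(n : ℝ)| + |n - v| := abs_sub _ _
        _ = _ := by rw [abs_of_nonneg hn]
    nlinarith [abs_nonneg ((n : ℝ) - v)]
  have h3 : (1 + |v|) ^ s ≤ ((n : ℝ) + 1) ^ s * (1 + |n - v|) := by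
    refine (rpow_le_rpow (by positivity) h1 hs).trans ?_
    rw [mul_rpow (by positivity) (by positivity)]
    gcongr
    exact rpow_le_self_of_one_le (by linarith [abs_nonneg ((n : ℝ) - v)]) hs1
  rw [rpow_neg (by positivity), rpow_neg (by positivity), inv_mul_eq_div,
    le_div_iff₀ (by positivity), inv_mul_le_iff₀ (by positivity)]
  exact h3

theorem one_add_mul_exp_neg_le {c : ℝ} (hc : 0 < c) {w : ℝ} (hw : 0 ≤ w) :
    (1 + w) * exp (-(c * w)) ≤ (1 + 2 / c) * exp (-(c / 2 * w)) := by
  have h1 : 1 + w ≤ (1 + 2 / c) * exp (c / 2 * w) := by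
    have h2 := add_one_le_exp (c / 2 * w)
    have h3 : 0 < exp (c / 2 * w) := exp_pos _
    have h4 : w ≤ 2 / c * exp (c / 2 * w) := by
      rw [div_mul_eq_mul_div, le_div_iff₀ hc]
      linarith
    have h5 : 1 ≤ exp (c / 2 * w) := one_le_exp (by positivity)
    linarith
  calc _ ≤ (1 + 2 / c) * exp (c / 2 * w) * exp (-(c * w)) := by gcongr
    _ = _ := by rw [mul_assoc, ← exp_add]; congr 2; ring

theorem min_mul_exp_le {θ c : ℝ} (hcθ : c ≤ θ) (hc1 : c ≤ 1 - θ) (w : ℝ) :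
    min 1 (exp w) * exp (-(θ * w)) ≤ exp (-(c * |w|)) := by
  rcases le_total 0 w with hw | hw
  · rw [abs_of_nonneg hw]
    calc _ ≤ 1 * exp (-(θ * w)) := by gcongr; exact min_le_left _ _
      _ ≤ _ := by rw [one_mul, exp_le_exp]; nlinarith
  · rw [abs_of_nonpos hw]
    calc _ ≤ exp w * exp (-(θ * w)) := by gcongr; exact min_le_right _ _
      _ ≤ _ := by rw [← exp_add, exp_le_exp]; nlinarith

/-- The `K`-functional of the lacunary series decays like `t ^ θ` up to a logarithmic factor. -/
theorem exists_rpow_mul_kFunctional_le (i : Fin d) {θ s : ℝ} (hθ₀ : 0 < θ) (hθ₁ : θ < 1)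
    (hs : 0 ≤ s) (hs1 : s ≤ 1) :
    ∃ C : ℝ, 0 ≤ C ∧ ∀ v : ℝ, ENNReal.ofReal (exp (-v) ^ (-θ)) *
      kFunctional (cbZeroNorm d) (lipZeroNorm d) (exp (-v))
        (fun x => lacunary (logCoeff θ s) (x i)) ≤ ENNReal.ofReal (C * (1 + |v|) ^ (-s)) := by
  -- Away from `n = v` the terms decay at rate `θ` for `n > v` and `1 - θ` for `n < v`.
  set c : ℝ := min θ (1 - θ) with hc
  have hc0 : 0 < c := lt_min hθ₀ (by linarith)
  obtain ⟨C, hC0, hC⟩ := exists_tsum_exp_neg_mul_abs_sub_le (half_pos hc0)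
  refine ⟨(1 + 2 / c) * C, by positivity, fun v => ?_⟩
  refine (mul_le_mul' le_rfl (kFunctional_lacunary_le i (logCoeff_nonneg θ s)
    (summable_logCoeff hθ₀ hs) (exp_pos _))).trans ?_
  rw [← ENNReal.ofReal_mul (by positivity), ← tsum_mul_left]
  refine ENNReal.ofReal_le_ofReal ?_
  obtain ⟨hsum, hle⟩ := hC v
  have hterm : ∀ n : ℕ, exp (-v) ^ (-θ) * (logCoeff θ s n * min 1 (exp (-v) * exp n)) ≤
      (1 + |v|) ^ (-s) * (1 + 2 / c) * exp (-(c / 2 * |n - v|)) := by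
    intro n
    have h1 : exp (-v) ^ (-θ) * exp (-(θ * n)) = exp (-(θ * (n - v))) := by
      rw [← exp_mul, ← exp_add]
      congr 1
      ring
    have h2 : exp (-v) * exp n = exp (n - v) := by
      rw [← exp_add]
      congr 1
      ring
    calc _ = ((n : ℝ) + 1) ^ (-s) * (min 1 (exp (n - v)) * exp (-(θ * (n - v)))) := by
          rw [logCoeff, h2, ← h1]
          ring
      _ ≤ ((1 + |v|) ^ (-s) * (1 + |n - v|)) * exp (-(c * |n - v|)) :=
          mul_le_mul (rpow_neg_le_mul_of_abs_sub hs hs1 n v)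
            (min_mul_exp_le (min_le_left _ _) (min_le_right _ _) _) (by positivity) (by positivity)
      _ = (1 + |v|) ^ (-s) * ((1 + |n - v|) * exp (-(c * |n - v|))) := by ring
      _ ≤ (1 + |v|) ^ (-s) * ((1 + 2 / c) * exp (-(c / 2 * |n - v|))) := by
          gcongr (1 + |v|) ^ (-s) * ?_
          exact one_add_mul_exp_neg_le hc0 (abs_nonneg _)
      _ = _ := by ring
  have hr := hsum.mul_left ((1 + |v|) ^ (-s) * (1 + 2 / c))
  have hl := hr.of_nonneg_of_le (fun n => by
    have := logCoeff_nonneg θ s n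
    positivity) hterm
  refine (hl.tsum_le_tsum hterm hr).trans ?_
  rw [tsum_mul_left]
  calc _ ≤ (1 + |v|) ^ (-s) * (1 + 2 / c) * C := by gcongr
    _ = _ := by ring

/-! ### Membership in the Hölder space and failure in the Besov space. -/

/-- For finite `q`, the majorant `(1 + |v|) ^ (-s)` is in `L_q(dv)` because `s q > 1`; for `q = ∞`
its boundedness suffices. -/
theorem lacunary_mem_hoelderSpace (i : Fin d) {θ s : ℝ} (hθ₀ : 0 < θ) (hθ₁ : θ < 1)
    (hs : 0 < s) (hs1 : s ≤ 1) {q : ℝ≥0∞} (hq : ENNReal.ofReal s⁻¹ < q) :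
    (fun x => lacunary (logCoeff θ s) (x i)) ∈ hoelderSpace d θ q := by
  refine ⟨⟨fun x => lacunary (logCoeff θ s) (x i), 0,
    (cbZeroNorm_lacunary_le i (logCoeff_nonneg θ s) (summable_logCoeff hθ₀ hs.le)).trans_lt
      ENNReal.ofReal_lt_top, by simp [lipZeroNorm], (add_zero _).symm⟩, ?_⟩
  obtain ⟨C, hC0, hC⟩ := exists_rpow_mul_kFunctional_le i hθ₀ hθ₁ hs.le hs1
  rw [interpolationNorm]
  rcases eq_or_ne q ∞ with rfl | hq'
  · rw [eLpNorm_exponent_top]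
    refine (eLpNormEssSup_le_of_ae_enorm_bound (C := ENNReal.ofReal C) ?_).trans_lt
      ENNReal.ofReal_lt_top
    filter_upwards [ae_haarIoi_pos] with t ht
    have h := hC (-log t)
    rw [neg_neg, exp_log ht] at h
    rw [enorm_eq_self]
    refine h.trans (ENNReal.ofReal_le_ofReal (mul_le_of_le_one_right hC0 ?_))
    exact rpow_le_one_of_one_le_of_nonpos (by linarith [abs_nonneg (-log t)]) (by linarith)
  · have hq0 : q ≠ 0 := (zero_le.trans_lt hq).ne'
    have hr : s⁻¹ < q.toReal := by
      rwa [← ENNReal.ofReal_lt_iff_lt_toReal (by positivity) hq']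
    have hr0 : 0 < q.toReal := (inv_pos.2 hs).trans hr
    rw [eLpNorm_lt_top_iff_lintegral_rpow_enorm_lt_top hq0 hq', lintegral_haarIoi]
    have hle : ∀ v : ℝ, ‖ENNReal.ofReal (exp (-v) ^ (-θ)) *
        kFunctional (cbZeroNorm d) (lipZeroNorm d) (exp (-v))
          (fun x => lacunary (logCoeff θ s) (x i))‖ₑ ^ q.toReal ≤
        ENNReal.ofReal (C ^ q.toReal) * ENNReal.ofReal ((1 + ‖v‖) ^ (-(s * q.toReal))) := by
      intro v
      rw [enorm_eq_self]
      refine (ENNReal.rpow_le_rpow (hC v) hr0.le).trans (le_of_eq ?_)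
      rw [ENNReal.ofReal_rpow_of_nonneg (by positivity) hr0.le, mul_rpow hC0 (by positivity),
        ENNReal.ofReal_mul (by positivity), ← rpow_mul (by positivity), norm_eq_abs, neg_mul]
    refine (lintegral_mono hle).trans_lt ?_
    rw [lintegral_const_mul' _ _ ENNReal.ofReal_ne_top]
    refine ENNReal.mul_lt_top ENNReal.ofReal_lt_top (finite_integral_one_add_norm ?_)
    rw [Module.finrank_self, Nat.cast_one]
    rwa [inv_lt_iff_one_lt_mul₀' hs] at hr

theorem le_rpow_mul_kFunctional_lacunary (i : Fin d) {θ s : ℝ} (hθ₀ : 0 < θ) (hs : 0 ≤ s)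
    {f : Lp ℝ 2 (gaussian d)} (hf : f =ᵐ[gaussian d] fun x => lacunary (logCoeff θ s) (x i))
    {v : ℝ} (hv : 2 ≤ v) :
    ENNReal.ofReal (exp (-θ) / 2 * (2 * v) ^ (-s)) ≤ ENNReal.ofReal (exp (-v) ^ (-θ)) *
      kFunctional (fun f : Lp ℝ 2 (gaussian d) => ‖f‖ₑ) (sobolevNorm d) (exp (-v)) f := by
  -- The frequency index is `⌈v⌉`. Rounding up loses at most `exp (-θ)`, and `⌈v⌉ + 1 ≤ v + 2 ≤ 2 v`
  -- since `v ≥ 2`.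
  have hm₀ := Nat.le_ceil v
  have hm₁ := Nat.ceil_lt_add_one (a := v) (by linarith)
  refine le_trans ?_ (mul_le_mul' le_rfl (ofReal_half_le_kFunctional_lacunary i
    (logCoeff_nonneg θ s) (summable_logCoeff hθ₀ hs) hf ⌈v⌉₊ (exp_le_exp.2 (neg_le_neg hm₀))))
  rw [← ENNReal.ofReal_mul (by positivity)]
  refine ENNReal.ofReal_le_ofReal ?_
  have h1 : exp (-v) ^ (-θ) * exp (-(θ * ⌈v⌉₊)) = exp (-(θ * (⌈v⌉₊ - v))) := by
    rw [← exp_mul, ← exp_add]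
    congr 1
    ring
  calc exp (-θ) / 2 * (2 * v) ^ (-s)
      ≤ exp (-(θ * (⌈v⌉₊ - v))) / 2 * ((⌈v⌉₊ : ℝ) + 1) ^ (-s) := by
        gcongr ?_ / 2 * ?_
        · rw [exp_le_exp]
          nlinarith
        · exact rpow_le_rpow_of_nonpos (by positivity) (by linarith) (by linarith)
    _ = _ := by
        rw [logCoeff, ← h1]
        ring

theorem not_mem_gaussianBesov_of_ae_eq_lacunary (i : Fin d) {θ : ℝ} (hθ₀ : 0 < θ) {q : ℝ≥0∞}
    (hq : q ≠ ∞) (hq0 : q ≠ 0) {f : Lp ℝ 2 (gaussian d)}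
    (hf : f =ᵐ[gaussian d] fun x => lacunary (logCoeff θ q.toReal⁻¹) (x i)) :
    f ∉ gaussianBesov d θ q := by
  rintro ⟨-, h⟩
  have hr0 : 0 < q.toReal := ENNReal.toReal_pos hq0 hq
  rw [interpolationNorm, eLpNorm_lt_top_iff_lintegral_rpow_enorm_lt_top hq0 hq,
    lintegral_haarIoi] at h
  -- With `s = 1 / q` the `q`-th power of the lower bound is exactly `κ / v`; the last halving comes
  -- from `(2 * v)⁻¹`.
  set κ : ℝ := (exp (-θ) / 2) ^ q.toReal / 2 with hκ
  have hκ0 : 0 < κ := by positivity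
  have hle : ∫⁻ v in Set.Ioi 2, ENNReal.ofReal (κ * v⁻¹) < ∞ := by
    refine lt_of_le_of_lt ((setLIntegral_mono' measurableSet_Ioi fun v hv => ?_).trans
      (setLIntegral_le_lintegral _ _)) h
    have hv2 : (2 : ℝ) < v := hv
    have hv0 : 0 < v := by linarith
    rw [enorm_eq_self]
    refine le_trans (le_of_eq ?_) (ENNReal.rpow_le_rpow (le_rpow_mul_kFunctional_lacunary i hθ₀
      (inv_pos.2 hr0).le hf hv2.le) hr0.le)
    rw [ENNReal.ofReal_rpow_of_nonneg (by positivity) hr0.le,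
      mul_rpow (by positivity) (by positivity), ← rpow_mul (by positivity), neg_mul,
      inv_mul_cancel₀ hr0.ne', rpow_neg_one, hκ, mul_inv]
    congr 1
    ring
  have hint : IntegrableOn (fun v : ℝ => κ * v⁻¹) (Set.Ioi 2) := by
    refine ⟨by fun_prop, ?_⟩
    rw [hasFiniteIntegral_iff_ofReal]
    · exact hle
    · filter_upwards [ae_restrict_mem measurableSet_Ioi] with v hv
      have hv0 : (0 : ℝ) < v := lt_trans two_pos hv
      simp only [Pi.zero_apply]
      positivity
  refine not_integrableOn_Ioi_inv (a := 2) ((hint.const_mul κ⁻¹).congr ?_)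
  filter_upwards with v
  field_simp

end SharpEmbedding

theorem mainTheorem2 (d : ℕ) (hd : 1 ≤ d) (θ : ℝ) (hθ₀ : 0 < θ) (hθ₁ : θ < 1)
    (q₁ q₂ : ENNReal) (hq₁ : 1 ≤ q₁) (hq : q₁ < q₂) :
    ¬ SharpEmbedding.hoelderSpace d θ q₂ ⊆
      {f | ∃ g ∈ SharpEmbedding.gaussianBesov d θ q₁,
        g =ᵐ[SharpEmbedding.gaussian d] f} := by
  intro hsub
  have htop : q₁ ≠ ∞ := hq.ne_top
  have h0 : q₁ ≠ 0 := (zero_lt_one.trans_le hq₁).ne'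
  have hr : 1 ≤ q₁.toReal := by
    simpa using ENNReal.toReal_mono htop hq₁
  obtain ⟨g, hg, hgf⟩ := hsub (SharpEmbedding.lacunary_mem_hoelderSpace ⟨0, hd⟩ hθ₀ hθ₁
    (s := q₁.toReal⁻¹) (by positivity) (inv_le_one_of_one_le₀ hr)
    (by rwa [inv_inv, ENNReal.ofReal_toReal htop]))
  exact SharpEmbedding.not_mem_gaussianBesov_of_ae_eq_lacunary ⟨0, hd⟩ hθ₀ htop h0 hgf hg
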